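/- Let $e\ge 0$ be an integer and let $X_e=\mathbb P(\mathcal O\oplus\mathcal O(-e))\to\mathbb{CP}^1$ be the $e$-th Hirzebruch surface. Let $L$ be a fibre and $M_0$ the special section, so that $L^2=0$, $M_0^2=-e$, $L\cdot M_0=1$, and put $M=eL+M_0$. For integers $a\ge 0$ and $b>0$ ($b\ge 0$ when $e=0$), a curve $C\subset X_e$ is said to be of type $(a,b)$ if it is irreducible and its homology class is $aL+bM\in H_2(X_e;\mathbb Z)$. Let $C\subset X_e$ be a curve of type $(a,b)$ (not necessarily rational or cuspidal), and let $r$ be the multiplicity of a singular point of $C$. Then $r\le b$. -/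

import Mathlib

open scoped LinearAlgebra.Projectivization Topology

noncomputable section

namespace Hirzebruch

/-! ### The surface -/

/-- Homogeneous coordinates: a pair of nonzero vectors `x = (x₀, x₁)`, `y = (y₀, y₁)`. -/
abbrev Coord : Type :=
  {v : Fin 2 → ℂ // v ≠ 0} × {v : Fin 2 → ℂ // v ≠ 0}

/-- `(x₀, x₁, y₀, y₁) ∼ (c x₀, c x₁, d y₀, d c⁻ᵉ y₁)` for `c, d ∈ ℂˣ`. -/
def Rel (e : ℕ) (z w : Coord) : Prop :=
  ∃ c d : ℂˣ, (∀ k, w.1.1 k = c * z.1.1 k) ∧ w.2.1 0 = d * z.2.1 0 ∧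
    w.2.1 1 = d * ((c⁻¹ ^ e : ℂˣ) : ℂ) * z.2.1 1

theorem rel_equivalence (e : ℕ) : Equivalence (Rel e) where
  refl z := ⟨1, 1, by simp⟩
  symm := by
    rintro z w ⟨c, d, h1, h2, h3⟩
    refine ⟨c⁻¹, d⁻¹, fun k => by simp [h1], by simp [h2], ?_⟩
    rw [h3]
    have hc : (c : ℂ) ≠ 0 := c.ne_zero
    have hd : (d : ℂ) ≠ 0 := d.ne_zero
    simp only [Units.val_pow_eq_pow_val, Units.val_inv_eq_inv_val, inv_inv, inv_pow]
    field_simp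
  trans := by
    rintro z w u ⟨c, d, h1, h2, h3⟩ ⟨c', d', h1', h2', h3'⟩
    refine ⟨c' * c, d' * d, fun k => ?_, ?_, ?_⟩
    · rw [h1', h1]; push_cast; ring
    · rw [h2', h2]; push_cast; ring
    · rw [h3', h3]
      simp only [mul_inv, mul_pow, Units.val_mul]
      ring

/-- The equivalence relation of homogeneous coordinates. -/
def setoid (e : ℕ) : Setoid Coord := ⟨Rel e, rel_equivalence e⟩

/-- The Hirzebruch surface `Xₑ = ℙ(𝒪 ⊕ 𝒪(-e))` over `ℂℙ¹`, in homogeneous coordinates: the fibre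
of `𝒪(-e)` over the line `ℓ ⊆ ℂ²` is `ℓ^{⊗ e}`, and the class of `(x, y)` is the line spanned by
`(y₀, y₁ x^{⊗ e})` in `ℂ ⊕ ℓ^{⊗ e}`, where `ℓ = [x]`. -/
def Surface (e : ℕ) : Type := Quotient (setoid e)

/-- The classical topology: the quotient topology. -/
instance (e : ℕ) : TopologicalSpace (Surface e) :=
  inferInstanceAs (TopologicalSpace (Quotient (setoid e)))

/-- The point with given homogeneous coordinates. -/
def mk (e : ℕ) (z : Coord) : Surface e := Quotient.mk (setoid e) z

/-- The bundle projection `Xₑ → ℂℙ¹`. -/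
def proj (e : ℕ) : Surface e → ℙ ℂ (Fin 2 → ℂ) :=
  Quotient.lift (fun z : Coord => Projectivization.mk ℂ z.1.1 z.1.2) (by
    rintro z w ⟨c, -, h, -⟩
    refine ((Projectivization.mk_eq_mk_iff ℂ _ _ _ _).2 ⟨c, ?_⟩).symm
    ext k
    simp [h k, Units.smul_def])

/-- The fibre of `Xₑ` over a point of `ℂℙ¹`. -/
def fibre (e : ℕ) (ℓ : ℙ ℂ (Fin 2 → ℂ)) : Set (Surface e) := proj e ⁻¹' {ℓ}

/-- The special section `M₀ = {y₁ = 0}`, of self-intersection `-e`. -/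
def specialSection (e : ℕ) : Set (Surface e) := mk e '' {z | z.2.1 1 = 0}

/-- The vector whose `i`-th coordinate is `1` and whose other coordinate is `t`. -/
def affineVec (i : Fin 2) (t : ℂ) : {v : Fin 2 → ℂ // v ≠ 0} :=
  ⟨Function.update (fun _ => t) i 1, fun h => by simpa using congrFun h i⟩

/-- The four affine charts `ℂ² → Xₑ`: the chart `(i, j)` parametrises the points with `xᵢ ≠ 0`
and `yⱼ ≠ 0` by their representatives with `xᵢ = yⱼ = 1`. -/
def chart (e : ℕ) (i : Fin 2 × Fin 2) (p : Fin 2 → ℂ) : Surface e :=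
  mk e (affineVec i.1 (p 0), affineVec i.2 (p 1))

/-- The affine open sets that cover `Xₑ`. -/
def U (e : ℕ) (i : Fin 2 × Fin 2) : Set (Surface e) := Set.range (chart e i)

/-! ### Curves, singular points, multiplicities -/

/-- The Zariski topology: a set is open if its preimage under each chart `ℂ² → Xₑ` is Zariski open
in `ℂ²`. -/
@[reducible]
def zariski (e : ℕ) : TopologicalSpace (Surface e) :=
  ⨆ i, TopologicalSpace.coinduced (chart e i)
    (TopologicalSpace.induced (MvPolynomial.pointToPoint (k := ℂ)) inferInstance)

/-- `C` is an irreducible (algebraic) curve in `Xₑ`: Zariski closed, irreducible and of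
dimension one. -/
def IsIrreducibleCurve {e : ℕ} (C : Set (Surface e)) : Prop :=
  IsClosed[zariski e] C ∧ @IsIrreducible _ (zariski e) C ∧
    @topologicalKrullDim C (@instTopologicalSpaceSubtype _ _ (zariski e)) = 1

/-- The ideal in `ℂ[t, s]` of `C` in an affine chart. -/
def chartIdeal {e : ℕ} (C : Set (Surface e)) (i : Fin 2 × Fin 2) :
    Ideal (MvPolynomial (Fin 2) ℂ) :=
  MvPolynomial.vanishingIdeal ℂ (chart e i ⁻¹' C)

/-- `x` is a singular point of the curve `C`: it lies on `C`, and the differentials at `x` of all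
the local equations of `C` vanish. -/
def IsSingularPoint {e : ℕ} (C : Set (Surface e)) (x : Surface e) : Prop :=
  x ∈ C ∧ ∃ i p, chart e i p = x ∧
    ∀ f ∈ chartIdeal C i, ∀ k, MvPolynomial.eval p (MvPolynomial.pderiv k f) = 0

/-- The multiplicity of `C` at `x`: the largest `n` such that the local equations of `C` lie in the
`n`-th power of the maximal ideal of `x`, i.e. the order of the Taylor expansion at `x` of
the local equation of `C`. It does not depend on the chart. -/
def multiplicity {e : ℕ} (C : Set (Surface e)) (x : Surface e) : ℕ∞ :=
  ⨆ (i : Fin 2 × Fin 2) (p : Fin 2 → ℂ) (_ : chart e i p = x) (n : ℕ)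
    (_ : chartIdeal C i ≤ MvPolynomial.vanishingIdeal ℂ {p} ^ n), (n : ℕ∞)

/-! ### Homology classes

By Poincaré duality `H₂(Xₑ; ℤ) = H²(Xₑ; ℤ)`, and by the first Chern class `H²(Xₑ; ℤ)` is the
group of topological complex line bundles on `Xₑ`, i.e. the first cohomology of the sheaf of
continuous functions with values in `ℂˣ`. As the charts are contractible, all line bundles are
trivial on them, so this is the first cohomology of the Čech complex of the cover by charts.
Under these identifications the homology class of a curve `C` is the class of the line bundle
`𝒪(C)`, whose transition functions are the quotients `fᵢ / fⱼ` of local equations of `C`. -/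

/-- Čech `0`-cochains of nowhere vanishing continuous functions. -/
abbrev Cochain0 (e : ℕ) : Type := (i : Fin 2 × Fin 2) → C(U e i, ℂˣ)

/-- Čech `1`-cochains of nowhere vanishing continuous functions. -/
abbrev Cochain1 (e : ℕ) : Type :=
  (i j : Fin 2 × Fin 2) → C((U e i ∩ U e j : Set (Surface e)), ℂˣ)

/-- Čech `1`-cocycles: `gᵢⱼ gⱼₖ = gᵢₖ` on `Uᵢ ∩ Uⱼ ∩ Uₖ`. -/
def cocycles (e : ℕ) : Subgroup (Cochain1 e) where
  carrier := {g | ∀ i j k x (hi : x ∈ U e i) (hj : x ∈ U e j) (hk : x ∈ U e k),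
    g i j ⟨x, hi, hj⟩ * g j k ⟨x, hj, hk⟩ = g i k ⟨x, hi, hk⟩}
  one_mem' := by intro i j k x hi hj hk; simp
  mul_mem' := by
    intro g h hg hh i j k x hi hj hk
    simp only [Pi.mul_apply, ContinuousMap.mul_apply]
    rw [← hg i j k x hi hj hk, ← hh i j k x hi hj hk, mul_mul_mul_comm]
  inv_mem' := by
    intro g hg i j k x hi hj hk
    simp only [Pi.inv_apply, ContinuousMap.inv_apply]
    rw [← hg i j k x hi hj hk, mul_inv]

/-- The Čech differential `(hᵢ) ↦ (hᵢ / hⱼ)`. -/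
def differential (e : ℕ) : Cochain0 e →* cocycles e where
  toFun h :=
    ⟨fun i j => (h i).comp (ContinuousMap.inclusion Set.inter_subset_left) /
        (h j).comp (ContinuousMap.inclusion Set.inter_subset_right), by
      intro i j k x hi hj hk
      exact div_mul_div_cancel _ _ _⟩
  map_one' := by
    ext i j x
    simp
  map_mul' g h := by
    ext i j x
    simp [mul_div_mul_comm]

/-- The group `H₂(Xₑ; ℤ)`. -/
abbrev H2 (e : ℕ) : Type := Additive (cocycles e ⧸ (differential e).range)

/-- `γ` is the homology class of the curve `C`: there are local equations `fᵢ` of `C` in the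
charts, and a cocycle `g` representing `γ` with `fᵢ = gᵢⱼ fⱼ` on `Uᵢ ∩ Uⱼ`. -/
def IsClassOf {e : ℕ} (C : Set (Surface e)) (γ : H2 e) : Prop :=
  ∃ (f : Fin 2 × Fin 2 → MvPolynomial (Fin 2) ℂ) (g : cocycles e),
    (∀ i, chartIdeal C i = Ideal.span {f i}) ∧
    (∀ i j p q, ∀ h : chart e i p = chart e j q,
      MvPolynomial.eval p (f i) =
        (g.1 i j ⟨chart e i p, ⟨p, rfl⟩, ⟨q, h.symm⟩⟩ : ℂˣ) * MvPolynomial.eval q (f j)) ∧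
    γ = Additive.ofMul (QuotientGroup.mk g)

/-- `C` is a curve of type `(a, b)`: an irreducible curve whose homology class is `a L + b M`,
where `L` is the class of a fibre and `M = e L + M₀`. Here `b > 0`, or `b ≥ 0` if `e = 0`. -/
def IsOfType {e : ℕ} (C : Set (Surface e)) (a b : ℕ) : Prop :=
  (0 < b ∨ e = 0) ∧ IsIrreducibleCurve C ∧
    ∃ (ℓ : ℙ ℂ (Fin 2 → ℂ)) (γ L M₀ : H2 e),
      IsClassOf C γ ∧ IsClassOf (fibre e ℓ) L ∧ IsClassOf (specialSection e) M₀ ∧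
        γ = a • L + b • (e • L + M₀)

end Hirzebruch

end

/-!
Let `C` be a curve of class `n L + b M₀` and `x` a point of `C`, and restrict the line bundle `𝒪(C)`
to the fibre `ℂℙ¹` through `x`. The degree of the restriction, a winding number, is additive in the
class and equals `0` for `L` and `1` for `M₀`, so it is `b`. Unless the fibre is contained in `C`, a
local equation of `C` at `x` thus restricts to a nonzero polynomial of degree at most `b` on the
fibre, and `C` has multiplicity at most `b` at `x`, since restriction does not decrease the order of
vanishing. If `C` is irreducible and contains the fibre, then it is the fibre, which is smooth.
-/

namespace Hirzebruch

open Polynomial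

/-! ### Clutching functions -/

theorem exists_continuousOn_exp_eq {s : Set ℂ} (hs : Convex ℝ s) (hs' : IsOpen s) (hne : s.Nonempty)
    {F : ℂ → ℂ} (hF : ContinuousOn F s) (hF0 : ∀ z ∈ s, F z ≠ 0) :
    ∃ f : ℂ → ℂ, ContinuousOn f s ∧ ∀ z ∈ s, Complex.exp (f z) = F z := by
  have := hs.contractibleSpace hne
  have hsc : IsSimplyConnected s := SimplyConnectedSpace.ofContractible s
  exact Complex.exists_continuousOn_eqOn_exp_comp hsc hs' hF fun ⟨z, hz, h0⟩ => hF0 z hz h0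

theorem eq_zero_of_exp_eq_zpow {r : ℝ} (hr : 0 < r) {f : ℂ → ℂ}
    (hf : ContinuousOn f (Metric.sphere 0 r)) {k : ℤ}
    (h : ∀ z ∈ Metric.sphere (0 : ℂ) r, Complex.exp (f z) = z ^ k) : k = 0 := by
  have hmem := circleMap_mem_sphere (0 : ℂ) hr.le
  have hcont : Continuous fun θ : ℝ => f (circleMap 0 r θ) - k * (θ * Complex.I) :=
    (hf.comp_continuous (continuous_circleMap 0 r) hmem).sub (by fun_prop)
  have hexp (θ : ℝ) :
      Complex.exp (f (circleMap 0 r θ) - k * (θ * Complex.I)) = (r : ℂ) ^ k := by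
    rw [Complex.exp_sub, h _ (hmem θ), circleMap_zero, mul_zpow, Complex.exp_int_mul,
      mul_div_cancel_right₀ _ (zpow_ne_zero _ (Complex.exp_ne_zero _))]
  have hconst := Complex.isCoveringMap_exp.const_of_comp hcont
    (fun θ θ' => Subtype.ext ((hexp θ).trans (hexp θ').symm)) (2 * Real.pi) 0
  have hperiod : circleMap 0 r (2 * Real.pi) = circleMap 0 r 0 := by
    simpa using periodic_circleMap 0 r 0
  have hk : (k : ℂ) * (2 * Real.pi * Complex.I) = 0 := by
    rw [hperiod] at hconst
    push_cast at hconst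
    linear_combination -hconst
  simpa [Complex.two_pi_I_ne_zero] using hk

theorem eq_zero_of_eq_zpow_mul {ρ : ℝ} (hρ : 0 < ρ) {F H : ℂ → ℂ}
    (hF : ContinuousOn F (Metric.ball 0 ρ)) (hF0 : ∀ w ∈ Metric.ball (0 : ℂ) ρ, F w ≠ 0)
    (hH : Continuous H) (hH0 : ∀ w, H w ≠ 0) {k : ℤ}
    (h : ∀ w ∈ Metric.ball (0 : ℂ) ρ, w ≠ 0 → F w = w ^ k * H w⁻¹) : k = 0 := by
  obtain ⟨f, hf, hfF⟩ := exists_continuousOn_exp_eq (convex_ball 0 ρ) Metric.isOpen_ball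
    (Metric.nonempty_ball.2 hρ) hF hF0
  obtain ⟨g, hg, hgH⟩ := exists_continuousOn_exp_eq convex_univ isOpen_univ Set.univ_nonempty
    hH.continuousOn fun w _ => hH0 w
  rw [continuousOn_univ] at hg
  have hball : Metric.sphere (0 : ℂ) (ρ / 2) ⊆ Metric.ball 0 ρ :=
    Metric.sphere_subset_ball (half_lt_self hρ)
  have hne : ∀ w ∈ Metric.sphere (0 : ℂ) (ρ / 2), w ≠ 0 := fun w hw =>
    ne_zero_of_mem_sphere (half_pos hρ).ne' ⟨w, hw⟩
  refine eq_zero_of_exp_eq_zpow (half_pos hρ) (f := fun w => f w - g w⁻¹)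
    ((hf.mono hball).sub (hg.comp_continuousOn (continuousOn_id.inv₀ hne))) fun w hw => ?_
  rw [Complex.exp_sub, hfF w (hball hw), hgH _ trivial, h w (hball hw) (hne w hw),
    mul_div_cancel_right₀ _ (hH0 _)]

/-- `φ` is a clutching function of degree `n`: the transition function of a topological line bundle
of degree `n` on the projective line, up to a change of trivialization over each of the two affine
lines, which have coordinates `z` and `z⁻¹`. -/
def IsClutchingOfDegree (φ : ℂˣ → ℂˣ) (n : ℤ) : Prop :=
  ∃ h₀ h₁ : C(ℂ, ℂˣ), ∀ z : ℂˣ, φ z = z ^ n * h₀ z / h₁ ↑z⁻¹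

namespace IsClutchingOfDegree

variable {φ ψ : ℂˣ → ℂˣ} {m n : ℤ}

theorem coboundary (h₀ h₁ : C(ℂ, ℂˣ)) : IsClutchingOfDegree (fun z => h₀ z / h₁ ↑z⁻¹) 0 :=
  ⟨h₀, h₁, by simp⟩

theorem zpow_mul_const (n : ℤ) (c : ℂˣ) : IsClutchingOfDegree (fun z => z ^ n * c) n :=
  ⟨.const ℂ c, 1, by simp⟩

theorem mul (hφ : IsClutchingOfDegree φ m) (hψ : IsClutchingOfDegree ψ n) :
    IsClutchingOfDegree (φ * ψ) (m + n) := by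
  obtain ⟨h₀, h₁, h⟩ := hφ
  obtain ⟨k₀, k₁, k⟩ := hψ
  refine ⟨h₀ * k₀, h₁ * k₁, fun z => ?_⟩
  simp only [Pi.mul_apply, h, k, zpow_add, ContinuousMap.mul_apply, ← mul_div_mul_comm,
    mul_mul_mul_comm]

theorem zpow (hφ : IsClutchingOfDegree φ m) (n : ℤ) : IsClutchingOfDegree (φ ^ n) (n * m) := by
  obtain ⟨h₀, h₁, h⟩ := hφ
  refine ⟨h₀ ^ n, h₁ ^ n, fun z => ?_⟩
  simp only [Pi.pow_apply, h, div_zpow, mul_zpow, ← zpow_mul, ContinuousMap.zpow_apply, mul_comm]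

theorem inv_comp_inv (hφ : IsClutchingOfDegree φ n) :
    IsClutchingOfDegree (fun z => (φ z⁻¹)⁻¹) n := by
  obtain ⟨h₀, h₁, h⟩ := hφ
  refine ⟨h₁, h₀, fun z => ?_⟩
  simp only [h, inv_inv, inv_zpow]
  rw [inv_div, div_mul_eq_div_div_swap, div_inv_eq_mul, mul_comm, mul_div_assoc]

end IsClutchingOfDegree

theorem eval_reverse {K : Type*} [Field K] (P : K[X]) {x : K} (hx : x ≠ 0) :
    P.reverse.eval x = x ^ P.natDegree * P.eval x⁻¹ := by
  let _ : Invertible x⁻¹ := invertibleOfNonzero (inv_ne_zero hx)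
  have h := eval₂_reverse_mul_pow (RingHom.id K) x⁻¹ P
  rw [eval₂_id, eval₂_id, invOf_eq_inv, inv_inv, inv_pow] at h
  rw [← h]
  field_simp

/-- Near `z = ∞` the functions `P z` and `Q z⁻¹` behave like `z ^ deg P` and `z ^ (-ord₀ Q)`. -/
theorem IsClutchingOfDegree.eq_natDegree_add_rootMultiplicity {φ : ℂˣ → ℂˣ} {n : ℤ}
    (hφ : IsClutchingOfDegree φ n) {P Q : ℂ[X]} (hP : P ≠ 0) (hQ : Q ≠ 0)
    (h : ∀ z : ℂˣ, P.eval ↑z = φ z * Q.eval (↑z⁻¹ : ℂ)) :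
    n = P.natDegree + Q.rootMultiplicity 0 := by
  obtain ⟨h₀, h₁, hφ⟩ := hφ
  obtain ⟨T, hQT, hT⟩ := exists_eq_pow_rootMultiplicity_mul_and_not_dvd Q hQ 0
  rw [map_zero, sub_zero] at hQT hT
  rw [X_dvd_iff, coeff_zero_eq_eval_zero] at hT
  have hR : P.reverse.eval 0 ≠ 0 := by
    rw [← coeff_zero_eq_eval_zero, coeff_zero_reverse]
    exact leadingCoeff_ne_zero.2 hP
  obtain ⟨ρ, hρ, hball⟩ := Metric.eventually_nhds_iff_ball.1
    ((P.reverse.continuous.continuousAt.eventually_ne hR).and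
      (T.continuous.continuousAt.eventually_ne hT))
  suffices (P.natDegree - n + Q.rootMultiplicity 0 : ℤ) = 0 by linarith
  refine eq_zero_of_eq_zpow_mul hρ (F := fun w => P.reverse.eval w * h₁ w / T.eval w)
    (H := fun w => h₀ w) ?_ ?_ (Units.continuous_val.comp h₀.continuous)
    (fun w => (h₀ w).ne_zero) fun w hw hw0 => ?_
  · exact (P.reverse.continuous.mul (Units.continuous_val.comp h₁.continuous)).continuousOn.div
      T.continuous.continuousOn fun w hw => (hball w hw).2
  · exact fun w hw => div_ne_zero (mul_ne_zero (hball w hw).1 (h₁ w).ne_zero) (hball w hw).2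
  · have hPw := h (Units.mk0 w hw0)⁻¹
    have hQw := congrArg (eval w) hQT
    have hTw := (hball w hw).2
    simp only [hφ, inv_inv, Units.val_mk0, Units.val_inv_eq_inv_val, Units.val_div_eq_div_val,
      Units.val_mul, Units.val_zpow_eq_zpow_val, inv_zpow] at hPw
    rw [eval_mul, eval_pow, eval_X] at hQw
    rw [eval_reverse P hw0, hPw, hQw, zpow_add₀ hw0, zpow_sub₀ hw0, zpow_natCast, zpow_natCast]
    field_simp [(h₁ w).ne_zero]

theorem eq_zero_of_eval_eq_mul_eval_inv {φ : ℂˣ → ℂˣ} {P Q : ℂ[X]}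
    (h : ∀ z : ℂˣ, P.eval ↑z = φ z * Q.eval (↑z⁻¹ : ℂ)) (hQ : Q = 0) : P = 0 := by
  refine eq_zero_of_infinite_isRoot P
    ((Set.finite_singleton (0 : ℂ)).infinite_compl.mono fun z hz => ?_)
  exact (h (Units.mk0 z hz)).trans (by simp [hQ])

theorem IsClutchingOfDegree.natDegree_le {φ : ℂˣ → ℂˣ} {n : ℤ} (hφ : IsClutchingOfDegree φ n)
    {P Q : ℂ[X]} (hP : P ≠ 0) (h : ∀ z : ℂˣ, P.eval ↑z = φ z * Q.eval (↑z⁻¹ : ℂ)) :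
    P.natDegree ≤ n := by
  have := hφ.eq_natDegree_add_rootMultiplicity hP (mt (eq_zero_of_eval_eq_mul_eval_inv h) hP) h
  lia

/-! ### Restriction of polynomials to vertical lines -/

section RestrictLine

variable {R : Type*} [CommSemiring R]

/-- The restriction of a polynomial in two variables to the line `{t} × R`, as a polynomial in the
second variable. -/
noncomputable def restrictLine (t : R) : MvPolynomial (Fin 2) R →ₐ[R] R[X] :=
  MvPolynomial.aeval ![C t, X]

theorem eval_restrictLine (t s : R) (f : MvPolynomial (Fin 2) R) :
    (restrictLine t f).eval s = MvPolynomial.eval ![t, s] f := by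
  have : (evalRingHom s).comp (restrictLine t).toRingHom = MvPolynomial.eval ![t, s] := by
    ext k
    · simp
    · fin_cases k <;> simp [restrictLine]
  exact RingHom.congr_fun this f

theorem eval_restrictLine_self (p : Fin 2 → R) (f : MvPolynomial (Fin 2) R) :
    (restrictLine (p 0) f).eval (p 1) = MvPolynomial.eval p f := by
  rw [eval_restrictLine]
  exact congrArg (MvPolynomial.eval · f) (FinVec.etaExpand_eq p)

theorem le_natDegree_restrictLine_of_mem_pow {k : Type*} [Field k] {p : Fin 2 → k} {n : ℕ}
    {f : MvPolynomial (Fin 2) k} (hf : f ∈ MvPolynomial.vanishingIdeal k {p} ^ n)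
    (h0 : restrictLine (p 0) f ≠ 0) : n ≤ (restrictLine (p 0) f).natDegree := by
  have hle : (MvPolynomial.vanishingIdeal k {p}).map (restrictLine (p 0)) ≤
      Ideal.span {X - C (p 1)} := by
    rw [Ideal.map_le_iff_le_comap]
    intro g hg
    rw [Ideal.mem_comap, Ideal.mem_span_singleton, dvd_iff_isRoot, IsRoot.def,
      eval_restrictLine_self]
    exact (MvPolynomial.mem_vanishingIdeal_singleton_iff p g).1 hg
  have hdvd : (X - C (p 1)) ^ n ∣ restrictLine (p 0) f := by
    rw [← Ideal.mem_span_singleton, ← Ideal.span_singleton_pow]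
    refine Ideal.pow_right_mono hle n ?_
    rw [← Ideal.map_pow]
    exact Ideal.mem_map_of_mem _ hf
  simpa using natDegree_le_of_dvd hdvd h0

end RestrictLine

/-! ### Zariski topologies -/

section Zariski

/-- The Zariski topology of the affine space `σ → k`. -/
@[reducible]
noncomputable def affineZariski (σ k : Type*) [Field k] : TopologicalSpace (σ → k) :=
  TopologicalSpace.induced (MvPolynomial.pointToPoint (k := k)) inferInstance

variable {σ k : Type*} [Field k]

theorem isClosed_affineZariski_iff {Z : Set (σ → k)} :
    IsClosed[affineZariski σ k] Z ↔
      ∃ S : Set (MvPolynomial σ k), Z = {p | ∀ f ∈ S, MvPolynomial.eval p f = 0} := by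
  have hpreimage (S : Set (MvPolynomial σ k)) :
      MvPolynomial.pointToPoint (k := k) ⁻¹' PrimeSpectrum.zeroLocus S =
        {p : σ → k | ∀ f ∈ S, MvPolynomial.eval p f = 0} :=
    Set.ext fun p => forall₂_congr fun f _ => MvPolynomial.mem_vanishingIdeal_singleton_iff p f
  rw [isClosed_induced_iff]
  constructor
  · rintro ⟨T, hT, rfl⟩
    obtain ⟨S, rfl⟩ := (PrimeSpectrum.isClosed_iff_zeroLocus T).1 hT
    exact ⟨S, hpreimage S⟩
  · rintro ⟨S, rfl⟩
    exact ⟨_, PrimeSpectrum.isClosed_zeroLocus S, hpreimage S⟩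

theorem exists_mem_vanishingIdeal_eval_ne_zero {Z : Set (σ → k)}
    (hZ : IsClosed[affineZariski σ k] Z) {p : σ → k} (hp : p ∉ Z) :
    ∃ f ∈ MvPolynomial.vanishingIdeal k Z, MvPolynomial.eval p f ≠ 0 := by
  obtain ⟨S, rfl⟩ := isClosed_affineZariski_iff.1 hZ
  simp only [Set.mem_ofPred_eq, not_forall] at hp
  obtain ⟨f, hf, hfp⟩ := hp
  exact ⟨f, fun q hq => hq f hf, hfp⟩

theorem isClosed_affineZariski_setOf_apply_eq (i : σ) (t : k) :
    IsClosed[affineZariski σ k] {p | p i = t} :=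
  isClosed_affineZariski_iff.2
    ⟨{MvPolynomial.X i - MvPolynomial.C t}, by ext p; simp [sub_eq_zero]⟩

theorem isClosed_affineZariski_singleton (p : σ → k) : IsClosed[affineZariski σ k] {p} := by
  have : ({p} : Set (σ → k)) = ⋂ i, {q | q i = p i} := by ext q; simp [funext_iff]
  rw [this]
  exact @isClosed_iInter _ _ (affineZariski σ k) _ fun i =>
    isClosed_affineZariski_setOf_apply_eq i (p i)

theorem isIrreducible_of_isInducing_image {X Y : Type*} [TopologicalSpace X] [TopologicalSpace Y]
    {f : X → Y} (hf : Topology.IsInducing f) {s : Set X} (hs : IsIrreducible (f '' s)) :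
    IsIrreducible s := by
  refine ⟨Set.image_nonempty.1 hs.nonempty, ?_⟩
  rintro u v hu hv ⟨x, hxs, hxu⟩ ⟨y, hys, hyv⟩
  obtain ⟨u', hu', rfl⟩ := hf.isOpen_iff.1 hu
  obtain ⟨v', hv', rfl⟩ := hf.isOpen_iff.1 hv
  obtain ⟨_, ⟨z, hzs, rfl⟩, hz⟩ :=
    hs.2 u' v' hu' hv' ⟨f x, ⟨x, hxs, rfl⟩, hxu⟩ ⟨f y, ⟨y, hys, rfl⟩, hyv⟩
  exact ⟨z, hzs, hz⟩

theorem isIrreducible_affineZariski {s : Set (σ → k)}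
    (hs : (MvPolynomial.vanishingIdeal k s).IsPrime) : @IsIrreducible _ (affineZariski σ k) s := by
  refine @isIrreducible_of_isInducing_image _ _ (affineZariski σ k) _
    MvPolynomial.pointToPoint (@Topology.IsInducing.mk _ _ (affineZariski σ k) _ _ rfl) s ?_
  rwa [PrimeSpectrum.isIrreducible_iff_vanishingIdeal_isPrime,
    MvPolynomial.vanishingIdeal_pointToPoint]

theorem vanishingIdeal_line [Infinite k] (t : k) :
    MvPolynomial.vanishingIdeal k {p : Fin 2 → k | p 0 = t} = RingHom.ker (restrictLine t) := by
  ext f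
  rw [RingHom.mem_ker]
  refine ⟨fun hf => Polynomial.funext fun s => ?_, ?_⟩
  · rw [eval_restrictLine, eval_zero]
    exact hf ![t, s] rfl
  · rintro hf p rfl
    rw [MvPolynomial.aeval_eq_eval]
    exact (eval_restrictLine_self p f).symm.trans (by rw [hf, eval_zero])

theorem isIrreducible_line [Infinite k] (t : k) :
    @IsIrreducible _ (affineZariski (Fin 2) k) {p | p 0 = t} :=
  isIrreducible_affineZariski (vanishingIdeal_line t ▸ RingHom.ker_isPrime _)

/-- `Z` lies strictly between one of its points and `C` in the order of irreducible closed sets,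
unless it is all of `C`. -/
theorem eq_of_subset_of_topologicalKrullDim_le_one {X : Type*} [TopologicalSpace X] [T1Space X]
    {C Z : Set X} (hC : IsIrreducible C) (hdim : topologicalKrullDim C ≤ 1) (hZ : IsIrreducible Z)
    (hZc : IsClosed Z) (hZ' : Z.Nontrivial) (hZC : Z ⊆ C) : Z = C := by
  have : IrreducibleSpace C := Subtype.irreducibleSpace hC
  have hZirr : IsIrreducible ((↑) ⁻¹' Z : Set C) :=
    isIrreducible_of_isInducing_image .subtypeVal (by simpa [Set.inter_eq_right.2 hZC] using hZ)
  let Z' : TopologicalSpace.IrreducibleCloseds C :=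
    ⟨(↑) ⁻¹' Z, hZirr, hZc.preimage continuous_subtype_val⟩
  rcases Order.krullDim_le_one_iff.1 hdim Z' with hmin | hmax
  · obtain ⟨x, hx, y, hy, hxy⟩ := hZ'
    let x' : TopologicalSpace.IrreducibleCloseds C :=
      ⟨{⟨x, hZC hx⟩}, isIrreducible_singleton, isClosed_singleton⟩
    have hle : Z' ≤ x' := hmin fun z hz => by rw [Set.mem_singleton_iff.1 hz]; exact hx
    exact absurd (congrArg Subtype.val (hle (show (⟨y, hZC hy⟩ : C) ∈ Z' from hy))).symm hxy
  · have hle := hmax (b := ⟨Set.univ, IrreducibleSpace.isIrreducible_univ C, isClosed_univ⟩)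
      fun _ _ => trivial
    exact hZC.antisymm fun x hx => hle (show (⟨x, hx⟩ : C) ∈ Set.univ from trivial)

end Zariski

/-! ### The charts and the fibres -/

section Charts

variable {e : ℕ} {i j k : Fin 2} {p q : Fin 2 → ℂ}

theorem continuous_affineVec (i : Fin 2) : Continuous (affineVec i) :=
  (Continuous.update (continuous_pi fun _ => continuous_id) i continuous_const).subtype_mk _

theorem continuous_chart (e : ℕ) (i : Fin 2 × Fin 2) : Continuous (chart e i) :=
  continuous_quotient_mk'.comp
    (((continuous_affineVec _).comp (continuous_apply 0)).prodMk
      ((continuous_affineVec _).comp (continuous_apply 1)))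

theorem mk_eq_mk_iff {z w : Coord} : mk e z = mk e w ↔ Rel e z w := Quotient.eq

theorem chart_zero_eq_chart_one (e : ℕ) (i : Fin 2) (t : ℂ) (z : ℂˣ) :
    chart e (i, 0) ![t, z] = chart e (i, 1) ![t, ↑z⁻¹] := by
  refine mk_eq_mk_iff.2 ⟨1, z⁻¹, ?_, ?_, ?_⟩ <;> simp [affineVec]

theorem proj_chart_eq_iff : proj e (chart e (i, j) p) = proj e (chart e (i, k) q) ↔ p 0 = q 0 := by
  change Projectivization.mk ℂ (affineVec i (p 0)).1 _ =
    Projectivization.mk ℂ (affineVec i (q 0)).1 _ ↔ _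
  refine ⟨fun h => ?_, fun h => by simp only [h]⟩
  obtain ⟨c, hc⟩ := (Projectivization.mk_eq_mk_iff ℂ _ _ _ _).1 h
  have hc1 : (c : ℂ) = 1 := by simpa [affineVec, Units.smul_def] using congrFun hc i
  obtain ⟨l, hl⟩ := exists_ne i
  simpa [affineVec, Units.smul_def, hl, hc1] using (congrFun hc l).symm

theorem chart_injective (e : ℕ) (i : Fin 2 × Fin 2) : Function.Injective (chart e i) := by
  obtain ⟨i, j⟩ := i
  intro p q hpq
  have h0 : p 0 = q 0 := proj_chart_eq_iff.1 (congrArg (proj e) hpq)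
  obtain ⟨c, d, hx, hy0, hy1⟩ := mk_eq_mk_iff.1 hpq
  obtain rfl : c = 1 := Units.ext (by simpa [affineVec] using (hx i).symm)
  ext k
  fin_cases k
  · exact h0
  · fin_cases j
    · have hd : (d : ℂ) = 1 := by simpa [affineVec] using hy0.symm
      simpa [affineVec, hd] using hy1.symm
    · have hd : (d : ℂ) = 1 := by simpa [affineVec] using hy1.symm
      simpa [affineVec, hd] using hy0.symm

theorem chart_mem_specialSection_iff :
    chart e (i, j) p ∈ specialSection e ↔ (affineVec j (p 1)).1 1 = 0 := by
  refine ⟨?_, fun h => ⟨_, h, rfl⟩⟩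
  rintro ⟨z, hz, h⟩
  obtain ⟨c, d, -, -, hy1⟩ := mk_eq_mk_iff.1 h
  exact hy1.trans (by rw [hz, mul_zero])

theorem exists_eq_chart_of_mem_fibre {y : Surface e}
    (hy : y ∈ fibre e (proj e (chart e (i, j) p))) : ∃ k s, y = chart e (i, k) ![p 0, s] := by
  induction y using Quotient.inductionOn with | h z =>
  obtain ⟨c, hc⟩ := (Projectivization.mk_eq_mk_iff ℂ _ _ z.1.2 (affineVec i (p 0)).2).1 hy
  have hx (l : Fin 2) : z.1.1 l = c * (affineVec i (p 0)).1 l := (congrFun hc l).symm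
  have hce : ((c⁻¹ ^ e : ℂˣ) : ℂ) ≠ 0 := Units.ne_zero _
  by_cases h0 : z.2.1 0 = 0
  · have h1 : z.2.1 1 ≠ 0 := fun h1 => z.2.2 (by ext l; fin_cases l <;> simp [h0, h1])
    refine ⟨1, 0, (mk_eq_mk_iff.2 ⟨c, Units.mk0 _ h1 * c ^ e, hx, ?_, ?_⟩).symm⟩
    · simp [affineVec, h0]
    · simp [affineVec]
  · refine ⟨0, z.2.1 1 / (z.2.1 0 * (c⁻¹ ^ e : ℂˣ)),
      (mk_eq_mk_iff.2 ⟨c, Units.mk0 _ h0, hx, ?_, ?_⟩).symm⟩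
    · simp [affineVec]
    · exact (mul_div_cancel₀ _ (mul_ne_zero h0 hce)).symm

end Charts

section ZariskiSurface

variable {e : ℕ} {C : Set (Surface e)}

theorem isClosed_zariski_iff :
    IsClosed[zariski e] C ↔ ∀ i, IsClosed[affineZariski (Fin 2) ℂ] (chart e i ⁻¹' C) := by
  rw [zariski, isClosed_iSup_iff]
  exact forall_congr' fun i => isClosed_coinduced

theorem continuous_chart_zariski (e : ℕ) (i : Fin 2 × Fin 2) :
    @Continuous _ _ (affineZariski (Fin 2) ℂ) (zariski e) (chart e i) :=
  (@continuous_iff_isClosed _ _ (affineZariski _ _) (zariski e) _).2 fun _ hZ =>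
    isClosed_zariski_iff.1 hZ i

theorem t1Space_zariski (e : ℕ) : @T1Space _ (zariski e) := by
  refine @T1Space.mk _ (zariski e) fun x => isClosed_zariski_iff.2 fun i => ?_
  rcases (Set.subsingleton_singleton.preimage (chart_injective e i)).eq_empty_or_singleton with
    h | ⟨p, h⟩
  · exact h ▸ @isClosed_empty _ (affineZariski _ _)
  · exact h ▸ isClosed_affineZariski_singleton p

theorem isClosed_zariski_fibre (ℓ : ℙ ℂ (Fin 2 → ℂ)) : IsClosed[zariski e] (fibre e ℓ) := by
  refine isClosed_zariski_iff.2 fun i => ?_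
  rcases (chart e i ⁻¹' fibre e ℓ).eq_empty_or_nonempty with h | ⟨p, rfl⟩
  · exact h ▸ @isClosed_empty _ (affineZariski _ _)
  · have hline : chart e i ⁻¹' fibre e (proj e (chart e i p)) = {q | q 0 = p 0} :=
      Set.ext fun q => proj_chart_eq_iff
    exact hline ▸ isClosed_affineZariski_setOf_apply_eq 0 (p 0)

theorem subset_fibre_of_fibre_subset (hC : IsIrreducibleCurve C) {i : Fin 2 × Fin 2} {p : Fin 2 → ℂ}
    (h : fibre e (proj e (chart e i p)) ⊆ C) : C ⊆ fibre e (proj e (chart e i p)) := by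
  let _ : TopologicalSpace (Surface e) := zariski e
  let _ : TopologicalSpace (Fin 2 → ℂ) := affineZariski (Fin 2) ℂ
  have := t1Space_zariski e
  have himage : chart e i '' {q | q 0 = p 0} ⊆ fibre e (proj e (chart e i p)) := by
    rintro _ ⟨q, hq, rfl⟩
    exact proj_chart_eq_iff.2 hq
  have hnontrivial : (chart e i '' {q | q 0 = p 0}).Nontrivial := by
    refine Set.Nontrivial.image ⟨![p 0, 0], rfl, ![p 0, 1], rfl, fun h01 => ?_⟩
      (chart_injective e i)
    exact zero_ne_one (congrFun h01 1)
  have hirr := ((isIrreducible_line (p 0)).image _ (continuous_chart_zariski e i).continuousOn)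
  rw [← eq_of_subset_of_topologicalKrullDim_le_one hC.2.1 hC.2.2.le hirr.closure isClosed_closure
    (hnontrivial.mono subset_closure) (closure_minimal (himage.trans h) hC.1)]
  exact closure_minimal himage (isClosed_zariski_fibre _)

theorem not_isSingularPoint_of_subset_fibre {x : Surface e} (h : C ⊆ fibre e (proj e x)) :
    ¬ IsSingularPoint C x := by
  rintro ⟨-, i, p, rfl, hp⟩
  have hmem : MvPolynomial.X 0 - MvPolynomial.C (p 0) ∈ chartIdeal C i := fun q hq => by
    simp [proj_chart_eq_iff.1 (h hq)]
  simpa using hp _ hmem 0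

theorem IsSingularPoint.not_fibre_subset {x : Surface e} (hx : IsSingularPoint C x)
    (hC : IsIrreducibleCurve C) : ¬ fibre e (proj e x) ⊆ C := fun h => by
  obtain ⟨-, i, p, rfl, -⟩ := id hx
  exact not_isSingularPoint_of_subset_fibre (subset_fibre_of_fibre_subset hC h) hx

end ZariskiSurface

/-! ### The degree on a fibre -/

section FibreDegree

variable {e : ℕ} {i : Fin 2} {t : ℂ} {γ δ : H2 e} {m n : ℤ}

/-- The transition function between the charts `(i, 0)` and `(i, 1)` of the line bundle with a given
cocycle, restricted to the fibre `{t} × ℂℙ¹` and written in the coordinate of the chart `(i, 0)`. -/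
noncomputable def transition (i : Fin 2) (t : ℂ) : cocycles e →* (ℂˣ → ℂˣ) where
  toFun g z := g.1 (i, 0) (i, 1)
    ⟨chart e (i, 0) ![t, z], ⟨_, rfl⟩, ⟨_, (chart_zero_eq_chart_one e i t z).symm⟩⟩
  map_one' := rfl
  map_mul' _ _ := rfl

theorem continuous_transition (i : Fin 2) (g : cocycles e) (z : ℂˣ) :
    Continuous fun t => transition i t g z :=
  (g.1 (i, 0) (i, 1)).continuous.comp
    (((continuous_chart e (i, 0)).comp (by fun_prop)).subtype_mk _)

theorem isClutchingOfDegree_transition_differential (i : Fin 2) (t : ℂ) (h : Cochain0 e) :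
    IsClutchingOfDegree (transition i t (differential e h)) 0 := by
  have hline (j : Fin 2) :
      Continuous fun s => (⟨chart e (i, j) ![t, s], ⟨_, rfl⟩⟩ : U e (i, j)) :=
    ((continuous_chart e (i, j)).comp (by fun_prop)).subtype_mk _
  convert IsClutchingOfDegree.coboundary ((h (i, 0)).comp ⟨_, hline 0⟩)
    ((h (i, 1)).comp ⟨_, hline 1⟩) using 1
  funext z
  simp only [ContinuousMap.comp_apply, ContinuousMap.coe_mk,
    ← chart_zero_eq_chart_one e i t z]
  rfl

/-- The class `γ` has intersection number `n` with the fibre `{t} × ℂℙ¹` in the charts `(i, _)`: the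
corresponding line bundle restricts to a bundle of degree `n`. -/
def HasFibreDegree (i : Fin 2) (t : ℂ) (γ : H2 e) (n : ℤ) : Prop :=
  ∃ g : cocycles e, Additive.ofMul (QuotientGroup.mk g) = γ ∧
    IsClutchingOfDegree (transition i t g) n

theorem HasFibreDegree.isClutchingOfDegree_transition {g : cocycles e}
    (h : HasFibreDegree i t (Additive.ofMul (QuotientGroup.mk g)) n) :
    IsClutchingOfDegree (transition i t g) n := by
  obtain ⟨g', hg', hdeg⟩ := h
  obtain ⟨k, hk⟩ := QuotientGroup.eq.1 (Additive.ofMul.injective hg')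
  have := hdeg.mul (isClutchingOfDegree_transition_differential i t k)
  rwa [hk, ← map_mul, mul_inv_cancel_left, add_zero] at this

theorem HasFibreDegree.add (hγ : HasFibreDegree i t γ m) (hδ : HasFibreDegree i t δ n) :
    HasFibreDegree i t (γ + δ) (m + n) := by
  obtain ⟨g, rfl, hg⟩ := hγ
  obtain ⟨h, rfl, hh⟩ := hδ
  exact ⟨g * h, rfl, by simpa only [map_mul] using hg.mul hh⟩

theorem HasFibreDegree.zsmul (hγ : HasFibreDegree i t γ m) (n : ℤ) :
    HasFibreDegree i t (n • γ) (n * m) := by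
  obtain ⟨g, rfl, hg⟩ := hγ
  exact ⟨g ^ n, rfl, by simpa only [map_zpow] using hg.zpow n⟩

end FibreDegree

/-! ### Local equations -/

/-- The polynomials `f` are equations of `C` in the charts, and `g` is the resulting cocycle of the
line bundle `𝒪(C)`. -/
structure HasLocalEquations {e : ℕ} (C : Set (Surface e))
    (f : Fin 2 × Fin 2 → MvPolynomial (Fin 2) ℂ) (g : cocycles e) : Prop where
  chartIdeal_eq : ∀ i, chartIdeal C i = Ideal.span {f i}
  eval_eq : ∀ i j p q, ∀ h : chart e i p = chart e j q,
    MvPolynomial.eval p (f i) =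
      (g.1 i j ⟨chart e i p, ⟨p, rfl⟩, ⟨q, h.symm⟩⟩ : ℂˣ) * MvPolynomial.eval q (f j)

theorem IsClassOf.exists_hasLocalEquations {e : ℕ} {C : Set (Surface e)} {γ : H2 e}
    (h : IsClassOf C γ) :
    ∃ f g, HasLocalEquations C f g ∧ Additive.ofMul (QuotientGroup.mk g) = γ := by
  obtain ⟨f, g, hf, hfg, rfl⟩ := h
  exact ⟨f, g, ⟨hf, hfg⟩, rfl⟩

namespace HasLocalEquations

variable {e : ℕ} {C : Set (Surface e)} {f : Fin 2 × Fin 2 → MvPolynomial (Fin 2) ℂ} {g : cocycles e}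

theorem mem_chartIdeal (h : HasLocalEquations C f g) (i : Fin 2 × Fin 2) : f i ∈ chartIdeal C i :=
  h.chartIdeal_eq i ▸ Ideal.mem_span_singleton_self _

theorem dvd_of_mem_chartIdeal (h : HasLocalEquations C f g) {i : Fin 2 × Fin 2}
    {P : MvPolynomial (Fin 2) ℂ} (hP : P ∈ chartIdeal C i) : f i ∣ P :=
  Ideal.mem_span_singleton.1 (h.chartIdeal_eq i ▸ hP)

theorem eval_ne_zero (h : HasLocalEquations C f g) (hC : IsClosed[zariski e] C) {i : Fin 2 × Fin 2}
    {p : Fin 2 → ℂ} (hp : chart e i p ∉ C) : MvPolynomial.eval p (f i) ≠ 0 := by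
  obtain ⟨P, hP, hPp⟩ := exists_mem_vanishingIdeal_eval_ne_zero (isClosed_zariski_iff.1 hC i) hp
  obtain ⟨Q, rfl⟩ := h.dvd_of_mem_chartIdeal hP
  rw [map_mul] at hPp
  exact left_ne_zero_of_mul hPp

theorem eval_restrictLine_zero (h : HasLocalEquations C f g) (i : Fin 2) (t : ℂ) (z : ℂˣ) :
    (restrictLine t (f (i, 0))).eval ↑z =
      transition i t g z * (restrictLine t (f (i, 1))).eval (↑z⁻¹ : ℂ) := by
  rw [eval_restrictLine, eval_restrictLine]
  exact h.eval_eq _ _ _ _ (chart_zero_eq_chart_one e i t z)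

theorem eval_restrictLine_one (h : HasLocalEquations C f g) (i : Fin 2) (t : ℂ) (z : ℂˣ) :
    (restrictLine t (f (i, 1))).eval ↑z =
      (transition i t g z⁻¹)⁻¹ * (restrictLine t (f (i, 0))).eval (↑z⁻¹ : ℂ) := by
  rw [h.eval_restrictLine_zero i t z⁻¹, inv_inv, Units.inv_mul_cancel_left]

theorem fibre_subset (h : HasLocalEquations C f g) (hC : IsClosed[zariski e] C) {i j : Fin 2}
    {p : Fin 2 → ℂ} (h0 : restrictLine (p 0) (f (i, j)) = 0) :
    fibre e (proj e (chart e (i, j) p)) ⊆ C := by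
  have hzero (k : Fin 2) : restrictLine (p 0) (f (i, k)) = 0 := by
    fin_cases j <;> fin_cases k
    · exact h0
    · exact eq_zero_of_eval_eq_mul_eval_inv (h.eval_restrictLine_one i (p 0)) h0
    · exact eq_zero_of_eval_eq_mul_eval_inv (h.eval_restrictLine_zero i (p 0)) h0
    · exact h0
  intro y hy
  obtain ⟨k, s, rfl⟩ := exists_eq_chart_of_mem_fibre hy
  by_contra hyC
  exact h.eval_ne_zero hC hyC (by rw [← eval_restrictLine, hzero k, eval_zero])

theorem natDegree_restrictLine_le (h : HasLocalEquations C f g) {i : Fin 2} {t : ℂ} {n : ℤ}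
    (hn : HasFibreDegree i t (Additive.ofMul (QuotientGroup.mk g)) n) {j : Fin 2}
    (h0 : restrictLine t (f (i, j)) ≠ 0) : (restrictLine t (f (i, j))).natDegree ≤ n := by
  have hφ := hn.isClutchingOfDegree_transition
  fin_cases j
  · exact hφ.natDegree_le h0 (h.eval_restrictLine_zero i t)
  · exact hφ.inv_comp_inv.natDegree_le h0 (h.eval_restrictLine_one i t)

theorem exists_transition_eq (h : HasLocalEquations C f g) {i : Fin 2} {t : ℂ} {n : ℕ}
    (h₀ : Associated (X ^ n) (restrictLine t (f (i, 0))))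
    (h₁ : IsUnit (restrictLine t (f (i, 1)))) :
    ∃ c : ℂˣ, transition i t g = fun z => z ^ n * c := by
  obtain ⟨u, hu⟩ := h₀
  obtain ⟨a, ha, hua⟩ := isUnit_iff.1 u.isUnit
  obtain ⟨b, hb, hfb⟩ := isUnit_iff.1 h₁
  refine ⟨ha.unit / hb.unit, funext fun z => Units.ext ?_⟩
  have hz := h.eval_restrictLine_zero i t z
  rw [← hu, ← hua, ← hfb, eval_mul, eval_pow, eval_X, eval_C, eval_C] at hz
  simp [← mul_div_assoc, hz, hb.ne_zero]

end HasLocalEquations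

/-! ### The classes of a fibre and of the special section -/

section Classes

variable {e : ℕ}

theorem isUnit_of_forall_eval_ne_zero {k : Type*} [Field k] [IsAlgClosed k] {P : k[X]}
    (h : ∀ x, P.eval x ≠ 0) : IsUnit P := by
  by_contra hP
  obtain ⟨x, hx⟩ := IsAlgClosed.exists_root P (mt isUnit_iff_degree_eq_zero.2 hP)
  exact h x hx

theorem HasLocalEquations.isUnit_restrictLine_of_fibre {ℓ : ℙ ℂ (Fin 2 → ℂ)}
    {f : Fin 2 × Fin 2 → MvPolynomial (Fin 2) ℂ} {g : cocycles e}
    (h : HasLocalEquations (fibre e ℓ) f g) {i j : Fin 2} {t : ℂ}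
    (ht : proj e (chart e (i, 0) ![t, 0]) ≠ ℓ) : IsUnit (restrictLine t (f (i, j))) := by
  refine isUnit_of_forall_eval_ne_zero fun s => ?_
  rw [eval_restrictLine]
  exact h.eval_ne_zero (isClosed_zariski_fibre ℓ) fun hs => ht ((proj_chart_eq_iff.2 rfl).trans hs)

theorem HasLocalEquations.transition_fibre_eq_const {ℓ : ℙ ℂ (Fin 2 → ℂ)}
    {f : Fin 2 × Fin 2 → MvPolynomial (Fin 2) ℂ} {g : cocycles e}
    (h : HasLocalEquations (fibre e ℓ) f g) (i : Fin 2) (t : ℂ) (z : ℂˣ) :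
    transition i t g z = transition i t g 1 := by
  -- The local equations vanish on the fibre over `ℓ` itself: constancy extends there by continuity.
  have hsub : {t | proj e (chart e (i, 0) ![t, 0]) = ℓ}.Subsingleton := fun t₁ h₁ t₂ h₂ =>
    proj_chart_eq_iff.1 (h₁.trans h₂.symm)
  refine congrFun (Continuous.ext_on (hsub.countable.dense_compl ℂ)
    (continuous_transition i g z) (continuous_transition i g 1) fun t' ht' => ?_) t
  obtain ⟨c, hc⟩ := h.exists_transition_eq (i := i) (t := t') (n := 0)
    (by simpa only [pow_zero] using
      (associated_one_iff_isUnit.2 (h.isUnit_restrictLine_of_fibre ht')).symm)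
    (h.isUnit_restrictLine_of_fibre ht')
  simp [hc]

theorem IsClassOf.hasFibreDegree_fibre {ℓ : ℙ ℂ (Fin 2 → ℂ)} {L : H2 e}
    (hL : IsClassOf (fibre e ℓ) L) (i : Fin 2) (t : ℂ) : HasFibreDegree i t L 0 := by
  obtain ⟨f, g, h, rfl⟩ := hL.exists_hasLocalEquations
  refine ⟨g, rfl, ?_⟩
  have hconst : transition i t g = fun z => z ^ (0 : ℤ) * transition i t g 1 :=
    funext fun z => by rw [zpow_zero, one_mul, h.transition_fibre_eq_const i t z]
  exact hconst ▸ .zpow_mul_const 0 _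

theorem HasLocalEquations.associated_X_of_specialSection
    {f : Fin 2 × Fin 2 → MvPolynomial (Fin 2) ℂ} {g : cocycles e}
    (h : HasLocalEquations (specialSection e) f g) (i : Fin 2) (t : ℂ) :
    Associated X (restrictLine t (f (i, 0))) := by
  have hmem (p) : chart e (i, 0) p ∈ specialSection e ↔ p 1 = 0 :=
    chart_mem_specialSection_iff.trans (by simp [affineVec])
  have hX : MvPolynomial.X 1 ∈ chartIdeal (specialSection e) (i, 0) := fun p hp => by
    simpa using (hmem p).1 hp
  refine associated_of_dvd_dvd ?_ ?_
  · rw [X_dvd_iff, coeff_zero_eq_eval_zero, eval_restrictLine]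
    exact h.mem_chartIdeal (i, 0) _ ((hmem _).2 rfl)
  · simpa [restrictLine] using map_dvd (restrictLine t) (h.dvd_of_mem_chartIdeal hX)

theorem HasLocalEquations.isUnit_restrictLine_of_specialSection
    {f : Fin 2 × Fin 2 → MvPolynomial (Fin 2) ℂ} {g : cocycles e}
    (h : HasLocalEquations (specialSection e) f g) (i : Fin 2) (t : ℂ) :
    IsUnit (restrictLine t (f (i, 1))) := by
  refine (isUnit_of_dvd_one (h.dvd_of_mem_chartIdeal fun p hp => ?_)).map (restrictLine t)
  simpa [affineVec] using chart_mem_specialSection_iff.1 hp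

theorem IsClassOf.hasFibreDegree_specialSection {M₀ : H2 e}
    (hM₀ : IsClassOf (specialSection e) M₀) (i : Fin 2) (t : ℂ) : HasFibreDegree i t M₀ 1 := by
  obtain ⟨f, g, h, rfl⟩ := hM₀.exists_hasLocalEquations
  obtain ⟨c, hc⟩ := h.exists_transition_eq (n := 1)
    (by simpa only [pow_one] using h.associated_X_of_specialSection i t)
    (h.isUnit_restrictLine_of_specialSection i t)
  exact ⟨g, rfl, hc ▸ .zpow_mul_const 1 c⟩

end Classes

end Hirzebruch

open Hirzebruch in
theorem mainTheorem5_general {e b : ℕ} {n : ℤ} {C : Set (Surface e)} (hC : IsClosed[zariski e] C)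
    {ℓ : ℙ ℂ (Fin 2 → ℂ)} {γ L M₀ : H2 e} (hγ : IsClassOf C γ) (hL : IsClassOf (fibre e ℓ) L)
    (hM₀ : IsClassOf (specialSection e) M₀) (hγ_eq : γ = n • L + b • M₀) {x : Surface e}
    (hx : ¬ fibre e (proj e x) ⊆ C) : multiplicity C x ≤ b := by
  obtain ⟨f, g, h, rfl⟩ := hγ.exists_hasLocalEquations
  refine iSup_le fun (i, j) => iSup_le fun p => iSup_le fun hp => iSup_le fun r =>
    iSup_le fun hr => ?_
  subst hp
  have hdeg : HasFibreDegree i (p 0) (Additive.ofMul (QuotientGroup.mk g)) b := by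
    rw [hγ_eq, ← natCast_zsmul M₀ b]
    simpa using ((hL.hasFibreDegree_fibre i (p 0)).zsmul n).add
      ((hM₀.hasFibreDegree_specialSection i (p 0)).zsmul b)
  have h0 : restrictLine (p 0) (f (i, j)) ≠ 0 := mt (h.fibre_subset hC) hx
  have hr_le := le_natDegree_restrictLine_of_mem_pow (hr (h.mem_chartIdeal (i, j))) h0
  exact_mod_cast hr_le.trans (Int.ofNat_le.1 (h.natDegree_restrictLine_le hdeg h0))

theorem mainTheorem5 (e a b : ℕ) (C : Set (Hirzebruch.Surface e))
    (hC : Hirzebruch.IsOfType C a b) (x : Hirzebruch.Surface e)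
    (hx : Hirzebruch.IsSingularPoint C x) :
    Hirzebruch.multiplicity C x ≤ (b : ℕ∞) := by
  obtain ⟨-, hCurve, ℓ, γ, L, M₀, hγ, hL, hM₀, hγ_eq⟩ := hC
  refine mainTheorem5_general hCurve.1 hγ hL hM₀ (n := a + b * e) ?_ (hx.not_fibre_subset hCurve)
  rw [hγ_eq, nsmul_add (e • L) M₀ b, ← mul_nsmul' L b e, ← add_assoc, ← natCast_zsmul L a,
    ← natCast_zsmul L (b * e), ← add_zsmul L, Nat.cast_mul]
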